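/- For $c>1$ let $\mathcal{E}_c\subset\mathbb{C}$ be the interior of the ellipse with foci $\pm1$ and sum of semi-axes equal to $c$, and for $M>0$ let $\mathcal{A}_0(\mathcal{E}_c,M)$ be the set of functions $f$ analytic on $\mathcal{E}_c$ with $|f(z)|\le M$ for all $z\in\mathcal{E}_c$ that take real values on the real line. Let $I(f)=\int_{-1}^{1}f(x)\,dx$. For $\mathcal{R}=(r_1,\dots,r_n)$ with integers $r_j\ge 1$, a quadrature of type $\mathcal{R}$ is a functional $Q$ for which there are nodes $z_1,\dots,z_n\in[-1,1]$ such that $Q(f)$ is a function, linear or not, of the $N=|\mathcal{R}|=r_1+\dots+r_n$ numbers $f^{(k)}(z_j)$, $1\le j\le n$, $0\le k\le r_j-1$; in particular this includes all linear quadratures $Q(f)=\sum_{j=1}^{n}\sum_{k=0}^{r_j-1}b_{kj}f^{(k)}(z_j)$. There exist $c_0>1$ and a function $\eta$ of $c$ alone, with $\eta(c)=O\left(\left|\frac{1}{\ln(c-1)}\right|\right)$ as $c\to1^+$, such that for every $c\in(1,c_0)$, all $M,\varepsilon>0$, every $n$ and $\mathcal{R}$, and every quadrature $Q$ of type $\mathcal{R}$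 with $|\mathcal{R}|=N$: if $|I(f)-Q(f)|<\varepsilon$ for all $f\in\mathcal{A}_0(\mathcal{E}_c,M)$, then $$N>\frac{-\ln\frac{M}{\varepsilon}}{4(c-1)\ln(c-1)}\,\bigl(1+\eta(c)\bigr).$$ -/

import Mathlib

open Filter Topology Asymptotics

namespace EllipseQuadrature

/-- The larger semi-axis of the ellipse with foci `-1`, `1` and sum of semi-axes `c`. -/
noncomputable def semiMajor (c : ℝ) : ℝ := (c ^ 2 + 1) / (2 * c)

/-- The smaller semi-axis of the ellipse with foci `-1`, `1` and sum of semi-axes `c`. -/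
noncomputable def semiMinor (c : ℝ) : ℝ := (c ^ 2 - 1) / (2 * c)

theorem semiMinor_pos {c : ℝ} (hc : 1 < c) : 0 < semiMinor c := by
  have : 0 < c ^ 2 - 1 := by nlinarith
  unfold semiMinor
  positivity

/-- The sum of the semi-axes is `c`. -/
theorem semiMajor_add_semiMinor {c : ℝ} (hc : 1 < c) : semiMajor c + semiMinor c = c := by
  have : c ≠ 0 := by positivity
  unfold semiMajor semiMinor
  field_simp
  ring

/-- The foci lie at distance `1` from the centre. -/
theorem semiMajor_sq_sub_semiMinor_sq {c : ℝ} (hc : 1 < c) :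
    semiMajor c ^ 2 - semiMinor c ^ 2 = 1 := by
  have : c ≠ 0 := by positivity
  unfold semiMajor semiMinor
  field_simp
  ring

/-- The interior of the ellipse with foci `-1`, `1` and sum of semi-axes `c` (for `c > 1`). -/
def ellipse (c : ℝ) : Set ℂ :=
  {z | z.re ^ 2 / semiMajor c ^ 2 + z.im ^ 2 / semiMinor c ^ 2 < 1}

/-- The functions that are analytic on the open set `D`, bounded there by `M`, and real on the
real line. Values outside `D` are irrelevant. -/
def realAnalyticBall (D : Set ℂ) (M : ℝ) : Set (ℂ → ℂ) :=
  {f | DifferentiableOn ℂ f D ∧ (∀ z ∈ D, ‖f z‖ ≤ M) ∧ ∀ x : ℝ, (x : ℂ) ∈ D → (f x).im = 0}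

/-- The integral over `[-1, 1]` with respect to Lebesgue measure. -/
noncomputable def integral (f : ℂ → ℂ) : ℂ := ∫ x in (-1 : ℝ)..1, f x

/-- All (possibly non-linear) quadratures that use `n` nodes `z 0, …, z (n - 1)` in `[-1, 1]`
and, at the node `z j`, the derivatives of the integrand of orders `0, …, r j - 1`. -/
def quadratures (n : ℕ) (r : Fin n → ℕ) : Set ((ℂ → ℂ) → ℂ) :=
  {Q | ∃ z : Fin n → ℝ, (∀ j, z j ∈ Set.Icc (-1 : ℝ) 1) ∧
    ∃ φ : ((j : Fin n) → Fin (r j) → ℂ) → ℂ,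
      ∀ f : ℂ → ℂ, Q f = φ (fun j k => iteratedDeriv (k : ℕ) f (z j : ℂ))}

/-- The quadratures that are linear combinations of the values
`f⁽ᵏ⁾(z j)`, `0 ≤ k ≤ r j - 1`. -/
def linearQuadratures (n : ℕ) (r : Fin n → ℕ) : Set ((ℂ → ℂ) → ℂ) :=
  {Q | ∃ z : Fin n → ℝ, (∀ j, z j ∈ Set.Icc (-1 : ℝ) 1) ∧
    ∃ b : (j : Fin n) → Fin (r j) → ℂ,
      ∀ f : ℂ → ℂ, Q f = ∑ j, ∑ k, b j k * iteratedDeriv (k : ℕ) f (z j : ℂ)}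

theorem linearQuadratures_subset (n : ℕ) (r : Fin n → ℕ) :
    linearQuadratures n r ⊆ quadratures n r := by
  rintro Q ⟨z, hz, b, hb⟩
  exact ⟨z, hz, fun y => ∑ j, ∑ k, b j k * y j k, hb⟩

end EllipseQuadrature

namespace EllipseQuadrature

/-! The proof uses a fooling function. For nodes `z j` of multiplicity `r j`, let g be the product
of `((w - z j)^2 / ((w - z j)^2 + a^2))^(r j)` with `a = 2 * semiMinor c`. All data of `M * g`
vanish, so `Q` cannot tell it from its negative, and its integral is below ε. Since `a` exceeds the
semi-minor axis, g is analytic on the ellipse, and it is bounded by 1 there. Each factor has a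
logarithm whose integral over any interval is at least -12a, wherever the node lies. By convexity of
exp, the integral of g over [-1, 1] is at least 2 exp(-6aN). As `semiMinor c ≤ c - 1`, this gives
ln(M/ε) < 12(c-1)N, which implies the claim once |ln(c-1)| ≥ 3. -/

/-! ### The logarithmic integral of one factor -/

/-- A primitive of `x ↦ log (x ^ 2 + a ^ 2) - 2 * log x`. -/
noncomputable def logPrimitive (a x : ℝ) : ℝ :=
  x * Real.log (x ^ 2 + a ^ 2) - 2 * (x * Real.log x) + 2 * a * Real.arctan (x / a)

theorem continuous_logPrimitive {a : ℝ} (ha : 0 < a) : Continuous (logPrimitive a) := by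
  have h1 : Continuous fun x : ℝ => Real.log (x ^ 2 + a ^ 2) :=
    Continuous.log (by fun_prop) fun x => by positivity
  have h2 := Real.continuous_mul_log
  have h3 : Continuous fun x : ℝ => Real.arctan (x / a) := by fun_prop
  unfold logPrimitive
  fun_prop

theorem hasDerivAt_logPrimitive {a x : ℝ} (ha : 0 < a) (hx : x ≠ 0) :
    HasDerivAt (logPrimitive a) (Real.log (x ^ 2 + a ^ 2) - 2 * Real.log x) x := by
  have hpos : 0 < x ^ 2 + a ^ 2 := by positivity
  have h1 : HasDerivAt (fun x : ℝ => Real.log (x ^ 2 + a ^ 2)) (2 * x / (x ^ 2 + a ^ 2)) x := by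
    have := (((hasDerivAt_id x).pow 2).add_const (a ^ 2)).log (by simpa using hpos.ne')
    simpa using this
  have h3 := ((hasDerivAt_id x).div_const a).arctan
  have := (((hasDerivAt_id x).mul h1).sub
    (((hasDerivAt_id x).mul (Real.hasDerivAt_log hx)).const_mul 2)).add (h3.const_mul (2 * a))
  refine this.congr_deriv ?_
  have hne : a ^ 2 + x ^ 2 ≠ 0 := by positivity
  simp only [id]
  field_simp
  ring

theorem abs_logPrimitive_le {a : ℝ} (ha : 0 < a) (x : ℝ) : |logPrimitive a x| ≤ 6 * a := by
  have harc : |2 * a * Real.arctan (x / a)| ≤ 4 * a := by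
    have : |Real.arctan (x / a)| ≤ 2 :=
      abs_le.2 ⟨by linarith [Real.neg_pi_div_two_lt_arctan (x / a), Real.pi_le_four],
        by linarith [Real.arctan_lt_pi_div_two (x / a), Real.pi_le_four]⟩
    rw [abs_mul, abs_of_pos (by positivity)]
    nlinarith
  have hlog : |x * Real.log (x ^ 2 + a ^ 2) - 2 * (x * Real.log x)| ≤ 2 * a := by
    rcases eq_or_ne x 0 with rfl | hx
    · simpa using ha.le
    have hx' : 0 < |x| := abs_pos.2 hx
    have h0 : Real.log (x ^ 2) ≤ Real.log (x ^ 2 + a ^ 2) :=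
      Real.log_le_log (by positivity) (by nlinarith)
    have h1 : Real.log (x ^ 2 + a ^ 2) ≤ Real.log ((|x| + a) ^ 2) :=
      Real.log_le_log (by positivity) (by nlinarith [sq_abs x])
    have h2 : Real.log (|x| + a) ≤ Real.log x + a / |x| := by
      have h : |x| + a = |x| * (1 + a / |x|) := by field_simp
      rw [h, Real.log_mul hx'.ne' (by positivity), Real.log_abs]
      linarith [Real.log_le_sub_one_of_pos (show 0 < 1 + a / |x| by positivity)]
    rw [Real.log_pow] at h0 h1
    push_cast at h0 h1
    have h3 : |Real.log (x ^ 2 + a ^ 2) - 2 * Real.log x| ≤ 2 * (a / |x|) := by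
      rw [abs_of_nonneg (by linarith)]
      linarith
    calc |x * Real.log (x ^ 2 + a ^ 2) - 2 * (x * Real.log x)|
        = |x| * |Real.log (x ^ 2 + a ^ 2) - 2 * Real.log x| := by
          rw [← abs_mul]; ring_nf
      _ ≤ |x| * (2 * (a / |x|)) := by gcongr
      _ = 2 * a := by field_simp
  unfold logPrimitive
  linarith [abs_add_le (x * Real.log (x ^ 2 + a ^ 2) - 2 * (x * Real.log x))
    (2 * a * Real.arctan (x / a))]

theorem intervalIntegrable_log_sub_log {a : ℝ} (ha : 0 < a) (u v : ℝ) :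
    IntervalIntegrable (fun x : ℝ => Real.log (x ^ 2 + a ^ 2) - 2 * Real.log x)
      MeasureTheory.volume u v := by
  have h1 : Continuous fun x : ℝ => Real.log (x ^ 2 + a ^ 2) :=
    Continuous.log (by fun_prop) fun x => by positivity
  exact (h1.intervalIntegrable u v).sub (intervalIntegral.intervalIntegrable_log'.const_mul 2)

theorem integral_log_sub_log_le {a : ℝ} (ha : 0 < a) (u v : ℝ) :
    ∫ x in u..v, (Real.log (x ^ 2 + a ^ 2) - 2 * Real.log x) ≤ 12 * a := by
  -- At 0 the primitive is continuous but not differentiable, because of the term `x * log x`.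
  rw [MeasureTheory.integral_eq_of_hasDerivAt_off_countable (logPrimitive a) _
    (Set.countable_singleton 0) (continuous_logPrimitive ha).continuousOn
    (fun x hx => hasDerivAt_logPrimitive ha (by simpa using hx.2))
    (intervalIntegrable_log_sub_log ha u v)]
  linarith [(abs_le.1 (abs_logPrimitive_le ha v)).2, (abs_le.1 (abs_logPrimitive_le ha u)).1]

/-! ### The fooling function -/

/-- A function with values in `[0, 1]` on the real line, with zeros of order `2 * r j` at `z j`. -/
noncomputable def zeroProduct {K : Type*} [Field K] {n : ℕ} (a : K) (z : Fin n → K)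
    (r : Fin n → ℕ) (w : K) : K :=
  ∏ j, ((w - z j) ^ 2 / ((w - z j) ^ 2 + a ^ 2)) ^ r j

theorem zeroProduct_ofReal {n : ℕ} (a : ℝ) (z : Fin n → ℝ) (r : Fin n → ℕ) (x : ℝ) :
    zeroProduct (a : ℂ) (fun j => (z j : ℂ)) r x = (zeroProduct a z r x : ℝ) := by
  simp [zeroProduct]

/-- Adding `4 * b^2` to the real part of `w^2` outweighs the `2 * w.im^2` by which that part falls
short of `‖w‖^2`. -/
theorem norm_sq_le_norm_sq_add_sq {b : ℝ} {w : ℂ} (hw : |w.im| < b) :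
    ‖w ^ 2‖ ≤ ‖w ^ 2 + ((2 * b : ℝ) : ℂ) ^ 2‖ := by
  have hsq : w.im ^ 2 < b ^ 2 := sq_lt_sq.2 (hw.trans_le (le_abs_self b))
  calc ‖w ^ 2‖ = w.re ^ 2 + w.im ^ 2 := by
        rw [norm_pow, Complex.sq_norm, Complex.normSq_apply]; ring
    _ ≤ (w ^ 2 + ((2 * b : ℝ) : ℂ) ^ 2).re := by
        rw [← Complex.ofReal_pow, Complex.add_re, Complex.ofReal_re, pow_two w, Complex.mul_re]
        nlinarith
    _ ≤ _ := Complex.re_le_norm _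

theorem sq_add_sq_ne_zero {b : ℝ} {w : ℂ} (hw : |w.im| < b) :
    w ^ 2 + ((2 * b : ℝ) : ℂ) ^ 2 ≠ 0 := by
  intro h
  have h1 := norm_sq_le_norm_sq_add_sq hw
  rw [h, norm_zero] at h1
  have hb : 0 < b := (abs_nonneg _).trans_lt hw
  have hw0 : w = 0 := by simpa using norm_le_zero_iff.1 h1
  subst hw0
  norm_num [hb.ne'] at h

theorem differentiableAt_zeroProduct {n : ℕ} {b : ℝ} (z : Fin n → ℝ) (r : Fin n → ℕ) {w : ℂ}
    (hw : |w.im| < b) :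
    DifferentiableAt ℂ (zeroProduct ((2 * b : ℝ) : ℂ) (fun j => (z j : ℂ)) r) w := by
  unfold zeroProduct
  refine DifferentiableAt.fun_finsetProd fun j _ => DifferentiableAt.fun_pow ?_ _
  refine DifferentiableAt.fun_div (by fun_prop) (by fun_prop) ?_
  exact sq_add_sq_ne_zero (by simpa using hw)

theorem norm_zeroProduct_le_one {n : ℕ} {b : ℝ} (z : Fin n → ℝ) (r : Fin n → ℕ) {w : ℂ}
    (hw : |w.im| < b) :
    ‖zeroProduct ((2 * b : ℝ) : ℂ) (fun j => (z j : ℂ)) r w‖ ≤ 1 := by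
  unfold zeroProduct
  rw [norm_prod]
  refine Finset.prod_le_one (fun _ _ => norm_nonneg _) fun j _ => ?_
  rw [norm_pow, norm_div]
  exact pow_le_one₀ (by positivity)
    (div_le_one_of_le₀ (norm_sq_le_norm_sq_add_sq (by simpa using hw)) (norm_nonneg _))

theorem iteratedDeriv_zeroProduct_eq_zero {n : ℕ} {a : ℝ} (ha : 0 < a) (z : Fin n → ℝ)
    (r : Fin n → ℕ) (j : Fin n) {k : ℕ} (hk : k < r j) :
    iteratedDeriv k (zeroProduct (a : ℂ) (fun j => (z j : ℂ)) r) (z j : ℂ) = 0 := by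
  have hden (i : Fin n) : ((z j : ℂ) - z i) ^ 2 + (a : ℂ) ^ 2 ≠ 0 := by
    norm_cast
    positivity
  have han : AnalyticAt ℂ (zeroProduct (a : ℂ) (fun j => (z j : ℂ)) r) (z j : ℂ) := by
    unfold zeroProduct
    refine Finset.analyticAt_fun_prod _ fun i _ => AnalyticAt.fun_pow ?_ _
    exact AnalyticAt.fun_div (by fun_prop) (by fun_prop) (hden i)
  refine (natCast_le_analyticOrderAt_iff_iteratedDeriv_eq_zero (n := r j) han).1 ?_ k hk
  rw [natCast_le_analyticOrderAt han]
  -- Only half of the zero's order `2 * r j` is needed; the square keeps the product nonnegative on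
  -- the real line.
  refine ⟨fun w => ((w - z j) / ((w - z j) ^ 2 + (a : ℂ) ^ 2)) ^ r j *
    ∏ i ∈ Finset.univ.erase j, ((w - z i) ^ 2 / ((w - z i) ^ 2 + (a : ℂ) ^ 2)) ^ r i, ?_,
    Eventually.of_forall fun w => ?_⟩
  · have hj : AnalyticAt ℂ (fun w : ℂ => (w - z j) / ((w - z j) ^ 2 + (a : ℂ) ^ 2)) (z j) :=
      AnalyticAt.fun_div (by fun_prop) (by fun_prop) (hden j)
    refine AnalyticAt.fun_mul (AnalyticAt.fun_pow hj _) ?_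
    refine Finset.analyticAt_fun_prod _ fun i _ => AnalyticAt.fun_pow ?_ _
    exact AnalyticAt.fun_div (by fun_prop) (by fun_prop) (hden i)
  · unfold zeroProduct
    rw [← Finset.mul_prod_erase _ _ (Finset.mem_univ j), smul_eq_mul, ← mul_assoc, ← mul_pow]
    congr 2
    ring

theorem zeroProduct_eq_exp {n : ℕ} {a : ℝ} (ha : 0 < a) (z : Fin n → ℝ) (r : Fin n → ℕ) {x : ℝ}
    (hx : ∀ j, x ≠ z j) :
    zeroProduct a z r x = Real.exp
      (-∑ j, r j * (Real.log ((x - z j) ^ 2 + a ^ 2) - 2 * Real.log (x - z j))) := by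
  rw [← Finset.sum_neg_distrib, Real.exp_sum]
  refine Finset.prod_congr rfl fun j _ => ?_
  have hne : x - z j ≠ 0 := sub_ne_zero.2 (hx j)
  have hlog : 2 * Real.log (x - z j) = Real.log ((x - z j) ^ 2) := by
    rw [Real.log_pow]; norm_num
  rw [← mul_neg, Real.exp_nat_mul, hlog, neg_sub, Real.exp_sub, Real.exp_log (by positivity),
    Real.exp_log (by positivity)]

theorem continuous_zeroProduct {n : ℕ} {a : ℝ} (ha : 0 < a) (z : Fin n → ℝ) (r : Fin n → ℕ) :
    Continuous (zeroProduct a z r) := by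
  unfold zeroProduct
  refine continuous_finsetProd _ fun j _ => Continuous.pow ?_ _
  exact Continuous.div (by fun_prop) (by fun_prop) fun x => by positivity

/-- Jensen's inequality in tangent-line form: `m` bounds the mean over [-1, 1] of minus the
logarithm of the product, and exp is replaced by its tangent at `-m`. -/
theorem two_mul_exp_le_integral_zeroProduct {n : ℕ} {a : ℝ} (ha : 0 < a) (z : Fin n → ℝ)
    (r : Fin n → ℕ) :
    2 * Real.exp (-(6 * a * (∑ j, r j : ℕ))) ≤ ∫ x in (-1 : ℝ)..1, zeroProduct a z r x := by
  set p : Fin n → ℝ → ℝ := fun j x =>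
    r j * (Real.log ((x - z j) ^ 2 + a ^ 2) - 2 * Real.log (x - z j)) with hp
  have hint (j : Fin n) : IntervalIntegrable (p j) MeasureTheory.volume (-1) 1 := by
    have := (intervalIntegrable_log_sub_log ha (-1 - z j) (1 - z j)).comp_sub_right (z j)
    simp only [sub_add_cancel] at this
    exact this.const_mul _
  have hle (j : Fin n) : ∫ x in (-1 : ℝ)..1, p j x ≤ r j * (12 * a) := by
    rw [hp]
    dsimp only
    rw [intervalIntegral.integral_const_mul, intervalIntegral.integral_comp_sub_right
      (fun x => Real.log (x ^ 2 + a ^ 2) - 2 * Real.log x)]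
    gcongr
    exact integral_log_sub_log_le ha _ _
  have hsum : IntervalIntegrable (fun x => ∑ j, p j x) MeasureTheory.volume (-1) 1 := by
    simpa [Finset.sum_fn] using IntervalIntegrable.sum Finset.univ fun j _ => hint j
  set m : ℝ := 6 * a * (∑ j, r j : ℕ) with hm
  have htotal : ∫ x in (-1 : ℝ)..1, ∑ j, p j x ≤ 2 * m := by
    rw [intervalIntegral.integral_finsetSum fun j _ => hint j]
    refine (Finset.sum_le_sum fun j _ => hle j).trans_eq ?_
    rw [← Finset.sum_mul, hm]
    push_cast
    ring
  have hconst : IntervalIntegrable (fun _ : ℝ => 1 + m) MeasureTheory.volume (-1) 1 :=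
    intervalIntegrable_const
  have hmono : ∫ x in (-1 : ℝ)..1, Real.exp (-m) * (1 + m - ∑ j, p j x) ≤
      ∫ x in (-1 : ℝ)..1, zeroProduct a z r x := by
    refine intervalIntegral.integral_mono_ae (by norm_num) ((hconst.sub hsum).const_mul _)
      ((continuous_zeroProduct ha z r).intervalIntegrable _ _) ?_
    have hnull : ∀ᵐ x : ℝ, x ∉ Set.range z :=
      (Set.finite_range z).countable.ae_notMem _
    filter_upwards [hnull] with x hx
    rw [zeroProduct_eq_exp ha z r fun j h => hx ⟨j, h.symm⟩]
    have h := Real.add_one_le_exp (m - ∑ j, p j x)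
    calc Real.exp (-m) * (1 + m - ∑ j, p j x)
        ≤ Real.exp (-m) * Real.exp (m - ∑ j, p j x) := by gcongr; linarith
      _ = Real.exp (-∑ j, p j x) := by rw [← Real.exp_add]; ring_nf
  refine le_trans ?_ hmono
  rw [intervalIntegral.integral_const_mul, intervalIntegral.integral_sub hconst hsum,
    intervalIntegral.integral_const, smul_eq_mul]
  have := Real.exp_pos (-m)
  nlinarith

/-! ### Lower bound for the number of data -/

theorem abs_im_lt_semiMinor {c : ℝ} (hc : 1 < c) {w : ℂ} (hw : w ∈ ellipse c) :
    |w.im| < semiMinor c := by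
  have hb := semiMinor_pos hc
  have h : w.im ^ 2 / semiMinor c ^ 2 < 1 :=
    (le_add_of_nonneg_left (by positivity)).trans_lt hw
  rw [div_lt_one (by positivity)] at h
  exact abs_lt_of_sq_lt_sq h hb.le

theorem neg_mem_realAnalyticBall {D : Set ℂ} {M : ℝ} {f : ℂ → ℂ} (hf : f ∈ realAnalyticBall D M) :
    -f ∈ realAnalyticBall D M :=
  ⟨hf.1.neg, fun z hz => by simpa using hf.2.1 z hz, fun x hx => by simpa using hf.2.2 x hx⟩

/-- If all the data used by `Q` vanish at `f`, then the error bound controls the integral. -/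
theorem norm_integral_lt_of_data_eq_zero {φ : Type*} {Q : (ℂ → ℂ) → ℂ} {D : Set ℂ}
    {M ε : ℝ} (data : (ℂ → ℂ) → φ) (hQ : ∀ f g, data f = data g → Q f = Q g)
    (h : ∀ f ∈ realAnalyticBall D M, ‖integral f - Q f‖ < ε) {f : ℂ → ℂ}
    (hf : f ∈ realAnalyticBall D M) (hdata : data f = data (-f)) : ‖integral f‖ < ε := by
  have h1 := h f hf
  have h2 := h (-f) (neg_mem_realAnalyticBall hf)
  have hneg : integral (-f) = -integral f := by simp [integral]
  rw [hneg, ← hQ _ _ hdata] at h2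
  have h3 : ‖(2 : ℂ) * integral f‖ < 2 * ε := by
    calc ‖(2 : ℂ) * integral f‖ = ‖(integral f - Q f) - (-integral f - Q f)‖ := by ring_nf
      _ ≤ ‖integral f - Q f‖ + ‖-integral f - Q f‖ := norm_sub_le _ _
      _ < 2 * ε := by linarith
  rw [norm_mul, Complex.norm_ofNat] at h3
  linarith

theorem two_mul_mul_exp_lt {c M ε : ℝ} (hc : 1 < c) (hM : 0 < M) {n : ℕ} {r : Fin n → ℕ}
    {Q : (ℂ → ℂ) → ℂ} (hQ : Q ∈ quadratures n r)
    (h : ∀ f ∈ realAnalyticBall (ellipse c) M, ‖integral f - Q f‖ < ε) :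
    2 * M * Real.exp (-(12 * semiMinor c * (∑ j, r j : ℕ))) < ε := by
  obtain ⟨z, -, φ, hφ⟩ := hQ
  have hb := semiMinor_pos hc
  set b := semiMinor c
  set g : ℂ → ℂ := zeroProduct ((2 * b : ℝ) : ℂ) (fun j => (z j : ℂ)) r with hg
  have hmem : (fun w => (M : ℂ) * g w) ∈ realAnalyticBall (ellipse c) M := by
    refine ⟨fun w hw => ?_, fun w hw => ?_, fun x _ => ?_⟩
    · exact ((differentiableAt_zeroProduct z r
        (abs_im_lt_semiMinor hc hw)).const_mul _).differentiableWithinAt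
    · rw [norm_mul, Complex.norm_real, Real.norm_of_nonneg hM.le]
      exact mul_le_of_le_one_right hM.le (norm_zeroProduct_le_one z r (abs_im_lt_semiMinor hc hw))
    · simp only [hg]
      rw [zeroProduct_ofReal, ← Complex.ofReal_mul, Complex.ofReal_im]
  have hderiv (j : Fin n) (k : Fin (r j)) :
      iteratedDeriv (k : ℕ) (fun w => (M : ℂ) * g w) (z j : ℂ) = 0 := by
    rw [iteratedDeriv_const_mul_field,
      iteratedDeriv_zeroProduct_eq_zero (by positivity) z r j k.2, mul_zero]
  have hlt := norm_integral_lt_of_data_eq_zero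
    (data := fun f (j : Fin n) (k : Fin (r j)) => iteratedDeriv (k : ℕ) f (z j : ℂ))
    (fun f g hfg => by rw [hφ, hφ]; exact congrArg φ hfg) h hmem
    (by funext j k; rw [iteratedDeriv_neg, hderiv, neg_zero])
  have hint : integral (fun w => (M : ℂ) * g w) =
      ((M * ∫ x in (-1 : ℝ)..1, zeroProduct (2 * b) z r x : ℝ) : ℂ) := by
    unfold integral
    simp only [hg, zeroProduct_ofReal]
    rw [intervalIntegral.integral_const_mul, intervalIntegral.integral_ofReal, Complex.ofReal_mul]
  rw [hint, Complex.norm_real] at hlt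
  have hI := two_mul_exp_le_integral_zeroProduct (show 0 < 2 * b by positivity) z r
  rw [show 6 * (2 * b) = 12 * b by ring] at hI
  calc 2 * M * Real.exp (-(12 * b * (∑ j, r j : ℕ)))
      = M * (2 * Real.exp (-(12 * b * (∑ j, r j : ℕ)))) := by ring
    _ ≤ M * ∫ x in (-1 : ℝ)..1, zeroProduct (2 * b) z r x := by gcongr
    _ < ε := (le_abs_self _).trans_lt hlt

theorem semiMinor_le_sub_one {c : ℝ} (hc : 1 < c) : semiMinor c ≤ c - 1 := by
  unfold semiMinor
  rw [div_le_iff₀ (by positivity)]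
  nlinarith

/-- A lower bound for the number of data that is stronger, as `c → 1⁺`, than the one with the
additional factor `|log (c - 1)|` in the denominator. -/
theorem log_div_lt_mul {c M ε : ℝ} (hc : 1 < c) (hM : 0 < M) (hε : 0 < ε) {n : ℕ} {r : Fin n → ℕ}
    {Q : (ℂ → ℂ) → ℂ} (hQ : Q ∈ quadratures n r)
    (h : ∀ f ∈ realAnalyticBall (ellipse c) M, ‖integral f - Q f‖ < ε) :
    Real.log (M / ε) < 12 * (c - 1) * (∑ j, r j : ℕ) := by
  have h1 := two_mul_mul_exp_lt hc hM hQ h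
  refine lt_of_lt_of_le ?_ (show 12 * semiMinor c * (∑ j, r j : ℕ) ≤ _ by
    gcongr; exact semiMinor_le_sub_one hc)
  rw [Real.log_lt_iff_lt_exp (by positivity), div_lt_iff₀ hε]
  rw [Real.exp_neg, ← div_eq_mul_inv, div_lt_iff₀ (Real.exp_pos _)] at h1
  linarith

end EllipseQuadrature

theorem mainTheorem8 :
    ∃ η : ℝ → ℝ,
      η =O[𝓝[>] (1 : ℝ)] (fun c : ℝ => |1 / Real.log (c - 1)|) ∧
      ∃ c₀ : ℝ, 1 < c₀ ∧
        ∀ c : ℝ, 1 < c → c < c₀ →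
        ∀ M ε : ℝ, 0 < M → 0 < ε →
        ∀ (n : ℕ) (r : Fin n → ℕ), (∀ j, 0 < r j) →
        ∀ N : ℕ, ∑ j, r j = N →
        ∀ Q ∈ EllipseQuadrature.quadratures n r,
          (∀ f ∈ EllipseQuadrature.realAnalyticBall (EllipseQuadrature.ellipse c) M,
            ‖EllipseQuadrature.integral f - Q f‖ < ε) →
          (N : ℝ) > -Real.log (M / ε) / (4 * (c - 1) * Real.log (c - 1)) * (1 + η c) := by
  -- No correction η is needed: for `c - 1 < exp (-3)`, `-4 * log (c - 1)` exceeds the constant 12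
  -- of `log_div_lt_mul`.
  refine ⟨fun _ => 0, isBigO_zero _ _, 1 + Real.exp (-3), by linarith [Real.exp_pos (-3)], ?_⟩
  intro c hc hc' M ε hM hε n r _ N hN Q hQ h
  have hδ : 0 < c - 1 := by linarith
  have hlog : Real.log (c - 1) < -3 := (Real.log_lt_iff_lt_exp hδ).2 (by linarith)
  have hmain := EllipseQuadrature.log_div_lt_mul hc hM hε hQ h
  rw [hN] at hmain
  have hle : 12 * (c - 1) * (N : ℝ) ≤ 4 * (c - 1) * -Real.log (c - 1) * N := by
    gcongr ?_ * _
    nlinarith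
  rw [add_zero, mul_one, neg_div, ← div_neg, ← mul_neg, gt_iff_lt,
    div_lt_iff₀ (mul_pos (by positivity) (by linarith))]
  linarith
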